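/- Let $n\ge 2$, $j\in\{0,1\}$, $s>0$ and $0<a<b<\infty$, and write points of $\mathbb{R}^n$ as $(\mathbf{x}',x_n)$ with $\mathbf{x}'\in\mathbb{R}^{n-1}$. Let $L^2_c(\{a\le x_n\le b\})$ be the space of (real- or complex-valued) square integrable functions on $\mathbb{R}^n$, modulo equality almost everywhere, that vanish almost everywhere outside some compact subset of $\{a\le x_n\le b\}$. For $f$ in this space, $t>0$ and $\mathbf{y}\in\mathbb{R}^{n-1}$ define $$\mathcal{R}_jf(t,\mathbf{y})=\int_{\Omega_j^+}r^{n-2}\int_{S^{n-2}}\frac{\sqrt{t+\left(\frac1s+(-1)^{j+1}\right)r^2}}{\sqrt{t+(-1)^{j+1}r^2}}\,f\left(r\Theta+\mathbf{y},\sqrt{\frac{t+(-1)^{j+1}r^2}{s}}\right)\mathrm{d}S^{n-2}(\Theta)\,\mathrm{d}r,$$ where $\Omega_0^+=[0,\sqrt t]$, $\Omega_1^+=[0,\infty)$ and $\mathrm{d}S^{n-2}$ is the surface measure on the unit sphere $S^{n-2}\subset\mathbb{R}^{n-1}$ (counting measure on $\{\pm1\}$ if $n=2$). Thus $\mathcal{R}_jf(t,\mathbf{y})$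 is the integral of $f$, with respect to surface area, over the part in $\{x_n\ge0\}$ of the ellipsoid ($j=0$) or two-sheeted hyperboloid ($j=1$) of revolution $(-1)^j|\mathbf{x}'-\mathbf{y}|^2+s\,x_n^2=t$, whose center $(\mathbf{y},0)$ lies on the plane $\{x_n=0\}$ (an ellipse or hyperbola if $n=2$). For every $f\in L^2_c(\{a\le x_n\le b\})$ this integral converges absolutely for almost every $(t,\mathbf{y})\in(0,\infty)\times\mathbb{R}^{n-1}$, and, up to null sets, it does not depend on the choice of the representative of $f$. The transform $\mathcal{R}_j$ is injective on $L^2_c(\{a\le x_n\le b\})$: if $f,g\in L^2_c(\{a\le x_n\le b\})$ and $\mathcal{R}_jf(t,\mathbf{y})=\mathcal{R}_jg(t,\mathbf{y})$ for almost every $(t,\mathbf{y})\in(0,\infty)\times\mathbb{R}^{n-1}$, then $f=g$ almost everywhere. -/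

import Mathlib

open MeasureTheory

/-- `ℝⁿ⁻¹`, with the Euclidean norm. -/
abbrev Hyper (n : ℕ) : Type := EuclideanSpace ℝ (Fin (n - 1))

/-- `f ∈ L²_c({a ≤ x_n ≤ b})`, for `f` defined on `ℝⁿ = ℝⁿ⁻¹ × ℝ` (the last factor is the `x_n`
axis): `f` is square integrable for Lebesgue measure and vanishes almost everywhere outside some
compact subset of the slab `{a ≤ x_n ≤ b}`. -/
def MemL2c {𝕜 : Type*} [RCLike 𝕜] {n : ℕ} (a b : ℝ) (f : Hyper n × ℝ → 𝕜) : Prop :=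
  MemLp f 2 volume ∧
    ∃ K : Set (Hyper n × ℝ), IsCompact K ∧ K ⊆ {x | a ≤ x.2 ∧ x.2 ≤ b} ∧
      ∀ᵐ x, x ∉ K → f x = 0

/-- The range of the radius: `[0, √t]` for `j = 0`, and `[0, ∞)` for `j = 1`. -/
noncomputable def radiusRange (j : Fin 2) (t : ℝ) : Set ℝ :=
  if j = 0 then Set.Icc 0 (Real.sqrt t) else Set.Ici 0

/-- The height `x_n` of the surface `(-1)ʲ |x' - y|² + s x_n² = t`, `x_n ≥ 0`, at distance
`r = |x' - y|` from its axis of revolution. -/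
noncomputable def surfaceHeight (j : Fin 2) (s t r : ℝ) : ℝ :=
  Real.sqrt ((t + (-1) ^ ((j : ℕ) + 1) * r ^ 2) / s)

/-- The arc length density, with respect to `r`, of the generating curve of the surface. -/
noncomputable def arcDensity (j : Fin 2) (s t r : ℝ) : ℝ :=
  Real.sqrt (t + (1 / s + (-1) ^ ((j : ℕ) + 1)) * r ^ 2) /
    Real.sqrt (t + (-1) ^ ((j : ℕ) + 1) * r ^ 2)

/-- The restriction of `f`, weighted by the arc length density, to the surface with parameter `t`
and center `(y, 0)`, in the coordinates `r` and `Θ ∈ Sⁿ⁻²`. -/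
noncomputable def surfaceIntegrand {𝕜 : Type*} [RCLike 𝕜] {n : ℕ} (j : Fin 2) (s : ℝ)
    (f : Hyper n × ℝ → 𝕜) (t : ℝ) (y : Hyper n) (r : ℝ)
    (Θ : Metric.sphere (0 : Hyper n) 1) : 𝕜 :=
  arcDensity j s t r • f (r • (Θ : Hyper n) + y, surfaceHeight j s t r)

/-- The surface measure on the unit sphere `Sⁿ⁻²` of `ℝⁿ⁻¹`. For `n = 2` the sphere is `{1, -1}`
and each of the two points has mass `1`. -/
noncomputable def sphereMeasure (n : ℕ) : Measure (Metric.sphere (0 : Hyper n) 1) :=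
  (volume : Measure (Hyper n)).toSphere

/-- The transform `R_j f (t, y)`: the integral of `f` over the (half) ellipsoid of revolution
(`j = 0`) or the sheet of a hyperboloid of revolution (`j = 1`)
`(-1)ʲ |x' - y|² + s x_n² = t`, `x_n ≥ 0`, with respect to surface area. For `n = 2` the integral
over `Θ = ± 1` and `r ≥ 0` is the integral over the curve parametrized by `x₁ = r Θ`. -/
noncomputable def radonTransform {𝕜 : Type*} [RCLike 𝕜] {n : ℕ} (j : Fin 2) (s : ℝ)
    (f : Hyper n × ℝ → 𝕜) (q : ℝ × Hyper n) : 𝕜 :=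
  ∫ r in radiusRange j q.1, r ^ (n - 2) •
    ∫ Θ, surfaceIntegrand j s f q.1 q.2 r Θ ∂(sphereMeasure n)

/-- The integral that defines `R_j f (t, y)` converges absolutely. -/
def RadonConverges {𝕜 : Type*} [RCLike 𝕜] {n : ℕ} (j : Fin 2) (s : ℝ)
    (f : Hyper n × ℝ → 𝕜) (q : ℝ × Hyper n) : Prop :=
  Integrable (fun z : ℝ × Metric.sphere (0 : Hyper n) 1 =>
      z.1 ^ (n - 2) • surfaceIntegrand j s f q.1 q.2 z.1 z.2)
    ((volume.restrict (radiusRange j q.1)).prod (sphereMeasure n))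

/-- Lebesgue measure on the parameter space `{(t, y) : t > 0, y ∈ ℝⁿ⁻¹}`. -/
noncomputable def parameterMeasure (n : ℕ) : Measure (ℝ × Hyper n) :=
  volume.restrict {q | 0 < q.1}

/-! Put `τ = s x_n²`, `e = (-1)^(j+1)` and `d = n - 1`. The surfaces become the paraboloids `τ = t +
e|w|²`, `x = y + w`, and the transform becomes `∫ A(τ, w) g(τ, x) dw`, where `g` is `f` in the new
coordinates and the weight `A = √(1 + |w|²/(sτ))` is invariant under `(τ, w) ↦ (c²τ, cw)`.

Test this against `t₊^κ L(y)^k` with `L` a linear functional. The volume-preserving shear `(t, y, w)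
↦ (τ, x, w)` moves the test function onto `g` as the kernel `A(τ, w) (τ - e|w|²)₊^κ L(x - w)^k`. The
binomial formula and the substitution `w = √τ v` then give a combination, over `l ≤ k`, of the
moments `∫ τ^(κ+(l+d)/2) L(x)^(k-l) g` (`integral_test_liftedIntegrand`). The coefficient for `l =
0` is positive, so if the transform vanishes, induction on `k` kills every moment with admissible
`κ` (`moment_eq_zero`).

Since `a > 0`, `g` lives on a compact set where `τ` is bounded away from `0`. The available powers
of `τ` are dense there by Stone–Weierstrass, and the exponential series in `L(x)` then shows that
the Fourier transform of `g` is zero (`ae_eq_zero_of_moment_eq_zero`). Polar coordinates and the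
substitution `τ = s x_n²` carry the result back to the original transform. -/

/-! ### Homogeneous kernels and their integrability -/

section Kernel

variable {E : Type*} [NormedAddCommGroup E]

/-- The truncated power `t ↦ t₊ ^ κ`. -/
noncomputable def posPow (t κ : ℝ) : ℝ := if 0 < t then t ^ κ else 0

/-- The surface area density, in terms of `τ = s x_n²` and `w = x' - y`. -/
noncomputable def areaFactor (s τ : ℝ) (w : E) : ℝ := Real.sqrt (1 + ‖w‖ ^ 2 / (s * τ))

/-- The exponents for which the kernels of degree at most `k` are integrable in dimension `d`. -/
def Admissible (e κ : ℝ) (d k : ℕ) : Prop :=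
  (e = -1 ∧ 2 * κ + k + d + 1 < 0) ∨ (e = 1 ∧ 0 ≤ κ)

lemma Admissible.mono {e κ : ℝ} {d k l : ℕ} (h : Admissible e κ d k) (hl : l ≤ k) :
    Admissible e κ d l := by
  rcases h with ⟨h1, h2⟩ | h
  · have : (l : ℝ) ≤ k := by exact_mod_cast hl
    exact Or.inl ⟨h1, by linarith⟩
  · exact Or.inr h

/-- The sum `2κ + k` is unchanged. This is the exchange of degree for exponent that occurs in the
lower terms of the induction on `k`. -/
lemma Admissible.shift {e κ : ℝ} {d k l : ℕ} (h : Admissible e κ d k) (hl : l ≤ k) :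
    Admissible e (κ + l / 2) d (k - l) := by
  rcases h with ⟨h1, h2⟩ | ⟨h1, h2⟩
  · refine Or.inl ⟨h1, ?_⟩
    push_cast [hl]
    linarith
  · exact Or.inr ⟨h1, by positivity⟩

lemma posPow_nonneg (t κ : ℝ) : 0 ≤ posPow t κ := by
  unfold posPow; split_ifs with h
  · positivity
  · exact le_rfl

lemma posPow_mul {c : ℝ} (hc : 0 < c) (t κ : ℝ) : posPow (c * t) κ = c ^ κ * posPow t κ := by
  unfold posPow
  by_cases h : 0 < t
  · rw [if_pos h, if_pos (mul_pos hc h), Real.mul_rpow hc.le h.le]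
  · rw [if_neg h, if_neg, mul_zero]
    rwa [mul_pos_iff_of_pos_left hc]

lemma measurable_posPow (κ : ℝ) : Measurable fun t => posPow t κ :=
  Measurable.ite measurableSet_Ioi (by fun_prop) measurable_const

lemma areaFactor_nonneg (s τ : ℝ) (w : E) : 0 ≤ areaFactor s τ w := Real.sqrt_nonneg _

lemma areaFactor_one_le {s : ℝ} (hs : 0 < s) (v : E) :
    areaFactor s 1 v ≤ Real.sqrt (1 + 1 / s) * (1 + ‖v‖ ^ 2) ^ (1 / 2 : ℝ) := by
  rw [← Real.sqrt_eq_rpow, ← Real.sqrt_mul (by positivity), areaFactor]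
  apply Real.sqrt_le_sqrt
  have : (0:ℝ) ≤ 1 / s := by positivity
  rw [mul_one, div_eq_mul_one_div]
  nlinarith [sq_nonneg ‖v‖]

lemma measurable_areaFactor [MeasurableSpace E] [BorelSpace E] [SecondCountableTopology E] (s : ℝ) :
    Measurable fun z : ℝ × E => areaFactor s z.1 z.2 := by
  unfold areaFactor; fun_prop

variable [NormedSpace ℝ E]

/-- The kernel of the transform tested against `t₊ ^ κ`, in scaled variables, times a power of a
linear functional. -/
noncomputable def momentKernel (s e κ : ℝ) (L : StrongDual ℝ E) (l : ℕ) (v : E) : ℝ :=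
  areaFactor s 1 v * posPow (1 - e * ‖v‖ ^ 2) κ * L v ^ l

lemma areaFactor_smul {c : ℝ} (hc : 0 < c) (s : ℝ) (v : E) :
    areaFactor s (c ^ 2) (c • v) = areaFactor s 1 v := by
  unfold areaFactor
  congr 2
  rw [norm_smul, Real.norm_of_nonneg hc.le, mul_pow]
  field_simp

lemma momentKernel_scaling {c : ℝ} (hc : 0 < c) (s e κ : ℝ) (L : StrongDual ℝ E) (l : ℕ) (v : E) :
    areaFactor s (c ^ 2) (c • v) * posPow (c ^ 2 - e * ‖c • v‖ ^ 2) κ * L (c • v) ^ l =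
      ((c ^ 2) ^ κ * c ^ l) * momentKernel s e κ L l v := by
  have : c ^ 2 - e * ‖c • v‖ ^ 2 = c ^ 2 * (1 - e * ‖v‖ ^ 2) := by
    rw [norm_smul, Real.norm_of_nonneg hc.le]; ring
  rw [areaFactor_smul hc, this, posPow_mul (by positivity), momentKernel, map_smul, smul_eq_mul]
  ring

variable [MeasurableSpace E] [BorelSpace E]

lemma measurable_momentKernel (s e κ : ℝ) (L : StrongDual ℝ E) (l : ℕ) :
    Measurable (momentKernel s e κ L l) := by
  unfold momentKernel areaFactor
  have h := (measurable_posPow κ).comp (f := fun v : E => 1 - e * ‖v‖ ^ 2) (by fun_prop)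
  simp only [Function.comp_def] at h
  fun_prop

variable [FiniteDimensional ℝ E] (μ : Measure E) [μ.IsAddHaarMeasure]

/-- For `e = -1` the kernel is `O((1 + |v|²)^((2κ + l + 1)/2))`, and admissibility makes this
integrable. For `e = 1` it is bounded, because `κ ≥ 0`, and vanishes off the unit ball. -/
lemma integrable_momentKernel {s e κ : ℝ} (hs : 0 < s) (L : StrongDual ℝ E) {l : ℕ}
    (h : Admissible e κ (Module.finrank ℝ E) l) : Integrable (momentKernel s e κ L l) μ := by
  set C := Real.sqrt (1 + 1 / s) * ‖L‖ ^ l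
  have hC : 0 ≤ C := by positivity
  have key : ∀ v : E, ‖momentKernel s e κ L l v‖ ≤
      C * ((1 + ‖v‖ ^ 2) ^ (1 / 2 : ℝ) * (1 + ‖v‖ ^ 2) ^ ((l : ℝ) / 2)) *
        posPow (1 - e * ‖v‖ ^ 2) κ := by
    intro v
    rw [momentKernel, norm_mul, norm_mul, norm_pow, Real.norm_of_nonneg (areaFactor_nonneg _ _ _),
      Real.norm_of_nonneg (posPow_nonneg _ _)]
    have h1 : ‖L v‖ ^ l ≤ ‖L‖ ^ l * (1 + ‖v‖ ^ 2) ^ ((l : ℝ) / 2) := by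
      have : (1 + ‖v‖ ^ 2) ^ ((l : ℝ) / 2) = (Real.sqrt (1 + ‖v‖ ^ 2)) ^ l := by
        rw [Real.sqrt_eq_rpow, ← Real.rpow_mul_natCast (by positivity)]
        congr 1; ring
      rw [this, ← mul_pow]
      gcongr
      refine (L.le_opNorm v).trans ?_
      gcongr
      exact Real.le_sqrt_of_sq_le (by linarith)
    calc _ ≤ (Real.sqrt (1 + 1 / s) * (1 + ‖v‖ ^ 2) ^ (1 / 2 : ℝ)) * posPow (1 - e * ‖v‖ ^ 2) κ *
          (‖L‖ ^ l * (1 + ‖v‖ ^ 2) ^ ((l : ℝ) / 2)) := by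
          have := posPow_nonneg (1 - e * ‖v‖ ^ 2) κ
          gcongr
          exact areaFactor_one_le hs v
      _ = _ := by ring
  rcases h with ⟨rfl, h⟩ | ⟨rfl, h⟩
  · have := (integrable_rpow_neg_one_add_norm_sq (E := E) (μ := μ)
      (r := -(2 * κ + l + 1)) (by linarith)).const_mul C
    refine this.mono' (measurable_momentKernel s _ κ L l).aestronglyMeasurable
      (Filter.Eventually.of_forall fun v => (key v).trans (le_of_eq ?_))
    have hp : 0 < 1 + ‖v‖ ^ 2 := by positivity
    rw [posPow, neg_one_mul, sub_neg_eq_add, if_pos hp, mul_assoc, ← Real.rpow_add hp,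
      ← Real.rpow_add hp]
    congr 2; ring
  · have hfin : IntegrableOn (fun _ : E => C * ((2:ℝ) ^ (1 / 2 : ℝ) * 2 ^ ((l : ℝ) / 2)))
        (Metric.closedBall 0 1) μ := by
      rw [integrableOn_const_iff]
      right
      exact (isCompact_closedBall (0 : E) 1).measure_lt_top
    rw [← integrable_indicator_iff measurableSet_closedBall] at hfin
    refine hfin.mono' (measurable_momentKernel s _ κ L l).aestronglyMeasurable
      (Filter.Eventually.of_forall fun v => (key v).trans ?_)
    by_cases hv : ‖v‖ ≤ 1
    · rw [Set.indicator_of_mem (by simpa using hv)]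
      have h2 : 1 + ‖v‖ ^ 2 ≤ 2 := by nlinarith [norm_nonneg v]
      have h3 : posPow (1 - 1 * ‖v‖ ^ 2) κ ≤ 1 := by
        unfold posPow; split_ifs with h'
        · exact Real.rpow_le_one h'.le (by nlinarith [norm_nonneg v]) h
        · exact zero_le_one
      have h4 := posPow_nonneg (1 - 1 * ‖v‖ ^ 2) κ
      calc _ ≤ C * ((2:ℝ) ^ (1 / 2 : ℝ) * 2 ^ ((l : ℝ) / 2)) * 1 := by gcongr
        _ = _ := mul_one _
    · rw [Set.indicator_of_notMem (by simpa using hv), posPow, if_neg, mul_zero]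
      push Not at hv
      nlinarith

lemma integral_momentKernel_zero_pos {s e κ : ℝ} (hs : 0 < s) (L : StrongDual ℝ E)
    (h : Admissible e κ (Module.finrank ℝ E) 0) : 0 < ∫ v, momentKernel s e κ L 0 v ∂μ := by
  have h0 : ∀ v : E, 0 ≤ momentKernel s e κ L 0 v := fun v => by
    rw [momentKernel, pow_zero, mul_one]
    exact mul_nonneg (areaFactor_nonneg _ _ _) (posPow_nonneg _ _)
  rw [integral_pos_iff_support_of_nonneg h0 (integrable_momentKernel μ hs L h)]
  refine (Metric.measure_ball_pos μ (0 : E) one_pos).trans_le (measure_mono fun v hv => ?_)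
  have hv : ‖v‖ < 1 := by simpa using hv
  have h1 : 0 < 1 - e * ‖v‖ ^ 2 := by
    rcases h with ⟨rfl, _⟩ | ⟨rfl, _⟩ <;> nlinarith [norm_nonneg v]
  have h2 : 0 < areaFactor s 1 v := Real.sqrt_pos.2 (by positivity)
  have h3 : 0 < posPow (1 - e * ‖v‖ ^ 2) κ := by
    rw [posPow, if_pos h1]; positivity
  rw [Function.mem_support, momentKernel, pow_zero, mul_one]
  positivity

end Kernel

/-! ### Testing the lifted transform: vanishing of moments -/

section Moments

variable {E : Type*} [NormedAddCommGroup E] [NormedSpace ℝ E] [FiniteDimensional ℝ E]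
  [MeasureSpace E] [BorelSpace E] [(volume : Measure E).IsAddHaarMeasure]
  {F : Type*} [NormedAddCommGroup F] [NormedSpace ℝ F]

omit [FiniteDimensional ℝ E] [MeasureSpace E] [BorelSpace E]
  [(volume : Measure E).IsAddHaarMeasure] in
lemma momentKernel_unscale {τ : ℝ} (hτ : 0 < τ) (s e κ : ℝ) (L : StrongDual ℝ E) (l : ℕ) (w : E) :
    areaFactor s τ w * posPow (τ - e * ‖w‖ ^ 2) κ * L w ^ l =
      (τ ^ κ * Real.sqrt τ ^ l) * momentKernel s e κ L l ((Real.sqrt τ)⁻¹ • w) := by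
  have hc : 0 < Real.sqrt τ := Real.sqrt_pos.2 hτ
  have := momentKernel_scaling hc s e κ L l ((Real.sqrt τ)⁻¹ • w)
  rwa [smul_inv_smul₀ hc.ne', Real.sq_sqrt hτ.le] at this

lemma sqrt_pow_mul_rpow {τ : ℝ} (hτ : 0 < τ) (κ : ℝ) (l d : ℕ) :
    Real.sqrt τ ^ d * (τ ^ κ * Real.sqrt τ ^ l) = τ ^ (κ + (l + d) / 2) := by
  rw [Real.sqrt_eq_rpow, ← Real.rpow_mul_natCast hτ.le, ← Real.rpow_mul_natCast hτ.le,
    ← Real.rpow_add hτ, ← Real.rpow_add hτ]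
  congr 1; ring

/-- The moment `∫ τ ^ p * L x ^ k * g (τ, x)`. -/
noncomputable def moment (g : ℝ × E → F) (L : StrongDual ℝ E) (k : ℕ) (p : ℝ) : F :=
  ∫ z : ℝ × E, (z.1 ^ p * L z.2 ^ k) • g z

/-- `g` vanishes outside the cylinder `[α, β] × {|x| ≤ R}`. -/
def SupportedInCylinder (α β R : ℝ) (g : ℝ × E → F) : Prop :=
  ∀ z, z ∉ Set.Icc α β ×ˢ Metric.closedBall (0 : E) R → g z = 0

omit [(volume : Measure E).IsAddHaarMeasure] in
lemma SupportedInCylinder.integrable_smul {α β R : ℝ} {g : ℝ × E → F}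
    (hg : SupportedInCylinder α β R g) (hi : Integrable g) {c : ℝ × E → ℝ}
    (hc : ContinuousOn c (Set.Icc α β ×ˢ Metric.closedBall (0 : E) R)) :
    Integrable fun z => c z • g z := by
  have hK : IsCompact (Set.Icc α β ×ˢ Metric.closedBall (0 : E) R) :=
    isCompact_Icc.prod (isCompact_closedBall _ _)
  have h := hi.integrableOn.continuousOn_smul hc hK
  rwa [integrableOn_iff_integrable_of_support_subset] at h
  intro z hz
  by_contra h'
  exact hz (by simp [hg z h'])

omit [(volume : Measure E).IsAddHaarMeasure] in
lemma SupportedInCylinder.integrable_moment {α β R : ℝ} {g : ℝ × E → F} (hα : 0 < α)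
    (hg : SupportedInCylinder α β R g) (hi : Integrable g) (L : StrongDual ℝ E) (k : ℕ) (p : ℝ) :
    Integrable fun z => (z.1 ^ p * L z.2 ^ k) • g z := by
  refine hg.integrable_smul hi (ContinuousOn.mul ?_ (by fun_prop))
  exact continuousOn_fst.rpow_const fun z hz => Or.inl (hα.trans_le hz.1.1).ne'

variable [CompleteSpace F]

/-- By Fubini, integrate in `w` first: the substitution `w = √τ v` extracts `τ^(κ + (l+d)/2)` and
leaves a constant independent of `(τ, x)`. -/
lemma integrable_testKernel {α β R : ℝ} {g : ℝ × E → F} (hα : 0 < α)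
    (hg : SupportedInCylinder α β R g) (hi : Integrable g) {s e κ : ℝ} (hs : 0 < s)
    (L : StrongDual ℝ E) {l : ℕ} (h : Admissible e κ (Module.finrank ℝ E) l) (m : ℕ) :
    Integrable (fun q : (ℝ × E) × E =>
      (areaFactor s q.1.1 q.2 * posPow (q.1.1 - e * ‖q.2‖ ^ 2) κ * L q.2 ^ l) •
        (L q.1.2 ^ m) • g q.1) ∧
    ∫ q : (ℝ × E) × E, (areaFactor s q.1.1 q.2 * posPow (q.1.1 - e * ‖q.2‖ ^ 2) κ * L q.2 ^ l) •
        (L q.1.2 ^ m) • g q.1 =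
      (∫ v, momentKernel s e κ L l v) • moment g L m (κ + (l + Module.finrank ℝ E) / 2) := by
  have hk := integrable_momentKernel volume hs L h
  have hτ : ∀ z : ℝ × E, z.1 ≤ 0 → g z = 0 := fun z hz =>
    hg z fun h' => absurd (h'.1.1.trans hz) (by linarith)
  have hslice : ∀ z : ℝ × E, 0 < z.1 → Integrable fun w : E =>
      areaFactor s z.1 w * posPow (z.1 - e * ‖w‖ ^ 2) κ * L w ^ l := fun z hz => by
    simp_rw [momentKernel_unscale hz]
    exact (hk.comp_smul (inv_ne_zero (Real.sqrt_pos.2 hz).ne')).const_mul _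
  have hint : Integrable (fun q : (ℝ × E) × E =>
      (areaFactor s q.1.1 q.2 * posPow (q.1.1 - e * ‖q.2‖ ^ 2) κ * L q.2 ^ l) •
        (L q.1.2 ^ m) • g q.1) := by
    have hm : AEStronglyMeasurable (fun q : (ℝ × E) × E =>
      (areaFactor s q.1.1 q.2 * posPow (q.1.1 - e * ‖q.2‖ ^ 2) κ * L q.2 ^ l) •
        (L q.1.2 ^ m) • g q.1) (volume : Measure ((ℝ × E) × E)) := by
      refine AEStronglyMeasurable.smul (Measurable.aestronglyMeasurable ?_)
        (AEStronglyMeasurable.smul (Measurable.aestronglyMeasurable (by fun_prop))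
          hi.aestronglyMeasurable.comp_fst)
      have h1 := (measurable_areaFactor (E := E) s).comp
        (f := fun q : (ℝ × E) × E => (q.1.1, q.2)) (by fun_prop)
      have h2 := (measurable_posPow κ).comp
        (f := fun q : (ℝ × E) × E => q.1.1 - e * ‖q.2‖ ^ 2) (by fun_prop)
      simp only [Function.comp_def] at h1 h2
      fun_prop
    refine (integrable_prod_iff hm).2 ⟨Filter.Eventually.of_forall fun z => ?_, ?_⟩
    · rcases le_or_gt z.1 0 with hz | hz
      · simp [hτ z hz]
      · exact (hslice z hz).smul_const ((L z.2 ^ m) • g z)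
    · have hM := ((hg.integrable_moment hα hi L m (κ + (l + Module.finrank ℝ E) / 2)).norm).const_mul
        (∫ v, ‖momentKernel s e κ L l v‖)
      refine hM.congr (Filter.Eventually.of_forall fun z => ?_)
      rcases le_or_gt z.1 0 with hz | hz
      · simp [hτ z hz]
      · simp_rw [momentKernel_unscale hz, norm_smul, norm_mul]
        rw [integral_mul_const, integral_const_mul,
          Measure.integral_comp_inv_smul_of_nonneg volume (fun v => ‖momentKernel s e κ L l v‖)
            (Real.sqrt_nonneg _), ← sqrt_pow_mul_rpow hz, norm_mul, norm_mul, smul_eq_mul,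
          Real.norm_of_nonneg (by positivity : 0 ≤ Real.sqrt z.1 ^ Module.finrank ℝ E)]
        ring
  refine ⟨hint, ?_⟩
  rw [Measure.volume_eq_prod, integral_prod _ hint, moment, ← integral_smul]
  refine integral_congr_ae (Filter.Eventually.of_forall fun z => ?_)
  rcases le_or_gt z.1 0 with hz | hz
  · simp [hτ z hz]
  · simp only
    simp_rw [momentKernel_unscale hz]
    rw [integral_smul_const, integral_const_mul, Measure.integral_comp_inv_smul_of_nonneg volume _
      (Real.sqrt_nonneg _), ← sqrt_pow_mul_rpow hz, smul_smul, smul_smul, smul_eq_mul]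
    congr 1; ring

/-- The kernel against which `R_j` tested with `t₊ ^ κ * L y ^ k` integrates `g`. -/
lemma integrable_testKernel_sub {α β R : ℝ} {g : ℝ × E → F} (hα : 0 < α)
    (hg : SupportedInCylinder α β R g) (hi : Integrable g) {s e κ : ℝ} (hs : 0 < s)
    (L : StrongDual ℝ E) {k : ℕ} (h : Admissible e κ (Module.finrank ℝ E) k) :
    Integrable (fun q : (ℝ × E) × E =>
      (areaFactor s q.1.1 q.2 * posPow (q.1.1 - e * ‖q.2‖ ^ 2) κ * L (q.1.2 - q.2) ^ k) • g q.1) ∧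
    ∫ q : (ℝ × E) × E,
      (areaFactor s q.1.1 q.2 * posPow (q.1.1 - e * ‖q.2‖ ^ 2) κ * L (q.1.2 - q.2) ^ k) • g q.1 =
      ∑ l ∈ Finset.range (k + 1), ((-1) ^ l * (k.choose l : ℝ) * ∫ v, momentKernel s e κ L l v) •
        moment g L (k - l) (κ + (l + Module.finrank ℝ E) / 2) := by
  have hexp : (fun q : (ℝ × E) × E =>
      (areaFactor s q.1.1 q.2 * posPow (q.1.1 - e * ‖q.2‖ ^ 2) κ * L (q.1.2 - q.2) ^ k) • g q.1) =
      fun q => ∑ l ∈ Finset.range (k + 1), ((-1) ^ l * (k.choose l : ℝ)) •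
        ((areaFactor s q.1.1 q.2 * posPow (q.1.1 - e * ‖q.2‖ ^ 2) κ * L q.2 ^ l) •
        (L q.1.2 ^ (k - l)) • g q.1) := by
    funext q
    have : L (q.1.2 - q.2) = -L q.2 + L q.1.2 := by rw [map_sub]; ring
    rw [this, add_pow, Finset.mul_sum, Finset.sum_smul]
    refine Finset.sum_congr rfl fun l _ => ?_
    rw [smul_smul, smul_smul, neg_pow]
    congr 1; ring
  have hT := fun l (hl : l ∈ Finset.range (k + 1)) => integrable_testKernel hα hg hi hs L
    (h.mono (Nat.lt_succ_iff.1 (Finset.mem_range.1 hl))) (k - l)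
  rw [hexp]
  refine ⟨integrable_finsetSum _ fun l hl => (hT l hl).1.fun_smul _, ?_⟩
  rw [integral_finsetSum _ fun l hl => (hT l hl).1.fun_smul _]
  refine Finset.sum_congr rfl fun l hl => ?_
  rw [integral_smul, (hT l hl).2, smul_smul]

/-- The weighted restriction of `g` to the surface with parameter `q.1` and center `q.2`, in the
coordinates `τ = s x_n²`. -/
noncomputable def liftedIntegrand (s e : ℝ) (g : ℝ × E → F) (q : ℝ × E) (w : E) : F :=
  areaFactor s (q.1 + e * ‖w‖ ^ 2) w • g (q.1 + e * ‖w‖ ^ 2, q.2 + w)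

/-- For fixed `w` the map is a translation in `(t, y)`. -/
lemma measurePreserving_shear (e : ℝ) :
    MeasurePreserving (fun q : (ℝ × E) × E => ((q.1.1 + e * ‖q.2‖ ^ 2, q.1.2 + q.2), q.2)) := by
  have h : MeasurePreserving (fun p : E × (ℝ × E) => (p.1, p.2 + (e * ‖p.1‖ ^ 2, p.1)))
      (volume.prod volume) (volume.prod volume) :=
    (MeasurePreserving.id volume).skew_product
      (g := fun (w : E) (q : ℝ × E) => q + (e * ‖w‖ ^ 2, w)) (by fun_prop)
      (Filter.Eventually.of_forall fun w => by
        have : (volume : Measure (ℝ × E)).IsAddHaarMeasure := by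
          rw [Measure.volume_eq_prod]; infer_instance
        exact (measurePreserving_add_right volume _).map_eq)
  exact Measure.measurePreserving_swap.comp (h.comp Measure.measurePreserving_swap)

lemma integral_test_liftedIntegrand {α β R : ℝ} {g : ℝ × E → F} (hα : 0 < α)
    (hg : SupportedInCylinder α β R g) (hi : Integrable g) {s e κ : ℝ} (hs : 0 < s)
    (L : StrongDual ℝ E) {k : ℕ} (h : Admissible e κ (Module.finrank ℝ E) k) :
    Integrable (fun q : (ℝ × E) × E =>
      (posPow q.1.1 κ * L q.1.2 ^ k) • liftedIntegrand s e g q.1 q.2) ∧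
    ∫ q : (ℝ × E) × E, (posPow q.1.1 κ * L q.1.2 ^ k) • liftedIntegrand s e g q.1 q.2 =
      ∑ l ∈ Finset.range (k + 1), ((-1) ^ l * (k.choose l : ℝ) * ∫ v, momentKernel s e κ L l v) •
        moment g L (k - l) (κ + (l + Module.finrank ℝ E) / 2) := by
  obtain ⟨h1, h2⟩ := integrable_testKernel_sub hα hg hi hs L h
  have hS := measurePreserving_shear (E := E) e
  have heq : (fun q : (ℝ × E) × E =>
      (posPow q.1.1 κ * L q.1.2 ^ k) • liftedIntegrand s e g q.1 q.2) =
      (fun q : (ℝ × E) × E => (areaFactor s q.1.1 q.2 * posPow (q.1.1 - e * ‖q.2‖ ^ 2) κ *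
        L (q.1.2 - q.2) ^ k) • g q.1) ∘
        fun q : (ℝ × E) × E => ((q.1.1 + e * ‖q.2‖ ^ 2, q.1.2 + q.2), q.2) := by
    funext q
    simp only [Function.comp, add_sub_cancel_right, liftedIntegrand, smul_smul]
    congr 1; ring
  rw [heq]
  refine ⟨hS.integrable_comp_of_integrable h1, ?_⟩
  rw [← h2]
  conv_rhs => rw [← hS.map_eq]
  rw [integral_map hS.measurable.aemeasurable (by rw [hS.map_eq]; exact h1.aestronglyMeasurable)]
  rfl

/-- A single test function that is nonzero for `t > 0` suffices: Fubini gives integrability of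
almost every slice, and the weight is constant on a slice. -/
lemma ae_integrable_liftedIntegrand {α β R : ℝ} {g : ℝ × E → F} (hα : 0 < α)
    (hg : SupportedInCylinder α β R g) (hi : Integrable g) {s e : ℝ} (hs : 0 < s)
    (he : e = -1 ∨ e = 1) :
    ∀ᵐ q : ℝ × E, 0 < q.1 → Integrable (liftedIntegrand s e g q) := by
  obtain ⟨κ, hκ⟩ : ∃ κ, Admissible e κ (Module.finrank ℝ E) 0 := by
    rcases he with he | he
    · refine ⟨-((Module.finrank ℝ E : ℝ) + 2) / 2, Or.inl ⟨he, ?_⟩⟩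
      push_cast; linarith
    · exact ⟨0, Or.inr ⟨he, le_rfl⟩⟩
  -- With degree `0` the factor is `0 ^ 0 = 1`, so the choice of functional is immaterial.
  have h := (integral_test_liftedIntegrand hα hg hi hs (0 : StrongDual ℝ E) hκ).1
  rw [Measure.volume_eq_prod] at h
  filter_upwards [h.prod_right_ae] with q hq hq0
  have hc : posPow q.1 κ ≠ 0 := by
    rw [posPow, if_pos hq0]; positivity
  simpa [integrable_fun_smul_iff hc] using hq

/-- The tested identities are triangular in the degree: the terms `l ≥ 1` involve only degrees below
`k`, and the remaining moment has a positive coefficient. -/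
lemma moment_eq_zero {α β R : ℝ} {g : ℝ × E → F} (hα : 0 < α)
    (hg : SupportedInCylinder α β R g) (hi : Integrable g) {s e : ℝ} (hs : 0 < s)
    (h0 : ∀ᵐ q : ℝ × E, 0 < q.1 → ∫ w, liftedIntegrand s e g q w = 0)
    (L : StrongDual ℝ E) (k : ℕ) :
    ∀ κ, Admissible e κ (Module.finrank ℝ E) k →
      moment g L k (κ + Module.finrank ℝ E / 2) = 0 := by
  induction k using Nat.strong_induction_on with
  | _ k ih =>
  intro κ h
  obtain ⟨h1, h2⟩ := integral_test_liftedIntegrand hα hg hi hs L h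
  have hz : ∫ q : (ℝ × E) × E, (posPow q.1.1 κ * L q.1.2 ^ k) • liftedIntegrand s e g q.1 q.2 =
      0 := by
    rw [Measure.volume_eq_prod] at h1 ⊢
    rw [integral_prod _ h1]
    refine integral_eq_zero_of_ae ?_
    filter_upwards [h0] with q hq
    simp only [integral_smul, Pi.zero_apply]
    by_cases hq0 : 0 < q.1
    · rw [hq hq0, smul_zero]
    · rw [posPow, if_neg hq0, zero_mul, zero_smul]
  -- Isolate the term `l = 0`; the others vanish by induction.
  rw [hz, Finset.sum_range_succ', Finset.sum_eq_zero fun l hl => ?_] at h2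
  · have hpos := integral_momentKernel_zero_pos volume hs L (h.mono (Nat.zero_le k))
    rw [zero_add, eq_comm] at h2
    simpa [hpos.ne'] using h2
  · have hl : l + 1 ≤ k := Nat.succ_le_of_lt (Finset.mem_range.1 hl)
    have := ih (k - (l + 1)) (by omega) _ (h.shift hl)
    have he : κ + (((l + 1 : ℕ) : ℝ) + Module.finrank ℝ E) / 2 =
      κ + ((l + 1 : ℕ) : ℝ) / 2 + Module.finrank ℝ E / 2 := by ring
    rw [he, this, smul_zero]

end Moments

/-! ### Vanishing moments determine the function -/

section Uniqueness

/-- An integrable function with vanishing Fourier transform is zero. -/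
lemma ae_eq_zero_of_forall_integral_cexp_eq_zero {V : Type*} [NormedAddCommGroup V]
    [NormedSpace ℝ V] [MeasurableSpace V] [BorelSpace V] [SecondCountableTopology V]
    [CompleteSpace V] {μ : Measure V} {g : V → ℝ} (hg : Integrable g μ)
    (h : ∀ Λ : StrongDual ℝ V, ∫ v, g v • Complex.exp (Λ v * Complex.I) ∂μ = 0) :
    g =ᵐ[μ] 0 := by
  have : IsFiniteMeasure (μ.withDensity fun v => ENNReal.ofReal (g v)) :=
    isFiniteMeasure_withDensity_ofReal hg.2
  have : IsFiniteMeasure (μ.withDensity fun v => ENNReal.ofReal (-g v)) :=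
    isFiniteMeasure_withDensity_ofReal hg.neg.2
  have hm1 : AEMeasurable (fun v => ENNReal.ofReal (g v)) μ := hg.aemeasurable.ennreal_ofReal
  have hm2 : AEMeasurable (fun v => ENNReal.ofReal (-g v)) μ := hg.aemeasurable.neg.ennreal_ofReal
  -- The positive and negative parts of `g` define finite measures with the same characteristic
  -- function.
  have key : (μ.withDensity fun v => ENNReal.ofReal (g v)) =
      μ.withDensity fun v => ENNReal.ofReal (-g v) := by
    refine Measure.ext_of_charFunDual (funext fun Λ => ?_)
    rw [charFunDual_apply, charFunDual_apply,
      integral_withDensity_eq_integral_toReal_smul₀ hm1 (by simp),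
      integral_withDensity_eq_integral_toReal_smul₀ hm2 (by simp), ← sub_eq_zero,
      ← integral_sub, ← h Λ]
    · refine integral_congr_ae (Filter.Eventually.of_forall fun v => ?_)
      simp only [ENNReal.toReal_ofReal', ← sub_smul]
      congr 1
      rcases le_total 0 (g v) with hv | hv
      · rw [max_eq_left hv, max_eq_right (by linarith)]; ring
      · rw [max_eq_right hv, max_eq_left (by linarith)]; ring
    all_goals
      simp only [ENNReal.toReal_ofReal']
      refine Integrable.smul_bdd (𝕜 := ℝ) ?_ 1 (Measurable.aestronglyMeasurable (by fun_prop))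
        (Filter.Eventually.of_forall fun v => by rw [Complex.norm_exp_ofReal_mul_I])
      first
      | exact hg.pos_part
      | exact hg.neg_part
  rw [withDensity_eq_iff hm1 hm2] at key
  · filter_upwards [key] with v hv
    have := congrArg ENNReal.toReal hv
    simp only [ENNReal.toReal_ofReal'] at this
    rcases le_total 0 (g v) with hv | hv
    · rw [max_eq_left hv, max_eq_right (by linarith)] at this; exact this
    · rw [max_eq_right hv, max_eq_left (by linarith)] at this
      simp only [Pi.zero_apply]; linarith
  · have := measure_lt_top (μ.withDensity fun v => ENNReal.ofReal (g v)) Set.univ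
    rw [withDensity_apply _ MeasurableSet.univ, Measure.restrict_univ] at this
    exact this.ne

/-- Approximation on `[α, β]` by polynomials in a nonconstant power. -/
lemma exists_polynomial_rpow_near {α β δ : ℝ} (hα : 0 < α) (hδ : δ ≠ 0) {c : ℝ → ℝ}
    (hc : ContinuousOn c (Set.Icc α β)) {ε : ℝ} (hε : 0 < ε) :
    ∃ P : Polynomial ℝ, ∀ τ ∈ Set.Icc α β, |P.eval (τ ^ δ) - c τ| < ε := by
  let f : C(Set.Icc α β, ℝ) := ⟨fun τ => (τ : ℝ) ^ δ,
    continuous_subtype_val.rpow_const fun τ => Or.inl (hα.trans_le τ.2.1).ne'⟩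
  have hsep : (Algebra.adjoin ℝ {f}).SeparatesPoints := by
    intro x y hxy
    refine ⟨f, ⟨f, Algebra.self_mem_adjoin_singleton ℝ f, rfl⟩, fun h => hxy ?_⟩
    exact Subtype.ext (Real.rpow_left_injOn hδ (hα.le.trans x.2.1) (hα.le.trans y.2.1) h)
  obtain ⟨⟨q, hq⟩, hq'⟩ :=
    ContinuousMap.exists_mem_subalgebra_near_continuous_of_separatesPoints _ hsep
      (fun τ : Set.Icc α β => c τ) hc.domRestrict ε hε
  rw [Algebra.adjoin_singleton_eq_range_aeval] at hq
  obtain ⟨P, rfl⟩ := hq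
  refine ⟨P, fun τ hτ => ?_⟩
  have := hq' ⟨τ, hτ⟩
  simpa [Polynomial.aeval_continuousMap_apply, f] using this

variable {E : Type*} [NormedAddCommGroup E] [NormedSpace ℝ E] [FiniteDimensional ℝ E]
  [MeasureSpace E] [BorelSpace E] [(volume : Measure E).IsAddHaarMeasure]

omit [(volume : Measure E).IsAddHaarMeasure] in
-- Approximate `c(τ) τ^(-p)` uniformly by polynomials in `τ^δ`. Multiplied by `τ^p`, these are
-- combinations of the powers `τ^(p + δi)`, whose moments vanish.
lemma integral_continuousOn_mul_eq_zero {α β R p δ : ℝ} {g : ℝ × E → ℝ} (hα : 0 < α)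
    (hg : SupportedInCylinder α β R g) (hi : Integrable g) {L : StrongDual ℝ E} {k : ℕ}
    (hδ : δ ≠ 0) (hz : ∀ i : ℕ, moment g L k (p + δ * i) = 0) {c : ℝ → ℝ}
    (hc : ContinuousOn c (Set.Icc α β)) :
    ∫ z, (c z.1 * L z.2 ^ k) * g z = 0 := by
  have hp : ContinuousOn (fun τ : ℝ => c τ * τ ^ (-p)) (Set.Icc α β) :=
    hc.mul (continuousOn_id.rpow_const fun τ hτ => Or.inl (hα.trans_le hτ.1).ne')
  have hcyl : ∀ a : ℝ → ℝ, ContinuousOn a (Set.Icc α β) →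
      Integrable fun z : ℝ × E => (a z.1 * L z.2 ^ k) * g z := fun a ha =>
    hg.integrable_smul hi ((ha.comp continuousOn_fst fun z hz => hz.1).mul (by fun_prop))
  have hI := hg.integrable_moment hα hi L k p
  have hpoly : ∀ P : Polynomial ℝ,
      ∫ z, (z.1 ^ p * P.eval (z.1 ^ δ) * L z.2 ^ k) * g z = 0 := by
    intro P
    have : (fun z : ℝ × E => (z.1 ^ p * P.eval (z.1 ^ δ) * L z.2 ^ k) * g z) =
        fun z => ∑ i ∈ Finset.range (P.natDegree + 1),
          P.coeff i * ((z.1 ^ (p + δ * i) * L z.2 ^ k) * g z) := by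
      funext z
      rcases le_or_gt z.1 0 with h | h
      · have h0 : g z = 0 := hg z fun h' => absurd (h'.1.1.trans h) (by linarith)
        simp [h0]
      · rw [Polynomial.eval_eq_sum_range, Finset.mul_sum, Finset.sum_mul, Finset.sum_mul]
        refine Finset.sum_congr rfl fun i _ => ?_
        rw [Real.rpow_add h, Real.rpow_mul_natCast h.le]
        ring
    simp only [this]
    rw [integral_finsetSum _ fun (i : ℕ) _ =>
      (hcyl (fun τ => τ ^ (p + δ * i)) (continuousOn_id.rpow_const fun τ hτ =>
        Or.inl (hα.trans_le hτ.1).ne')).const_mul _]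
    refine Finset.sum_eq_zero fun i _ => ?_
    rw [integral_const_mul]
    simpa [moment] using Or.inr (hz i)
  have hbound : ∀ ε : ℝ, 0 < ε → |∫ z, (c z.1 * L z.2 ^ k) * g z| ≤
      ε * ∫ z : ℝ × E, ‖(z.1 ^ p * L z.2 ^ k) • g z‖ := by
    intro ε hε
    obtain ⟨P, hP⟩ := exists_polynomial_rpow_near hα hδ hp hε
    have hPc : ContinuousOn (fun τ : ℝ => τ ^ p * P.eval (τ ^ δ)) (Set.Icc α β) :=
      (continuousOn_id.rpow_const fun τ hτ => Or.inl (hα.trans_le hτ.1).ne').mul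
        (P.continuous.comp_continuousOn
          (continuousOn_id.rpow_const fun τ hτ => Or.inl (hα.trans_le hτ.1).ne'))
    rw [← sub_zero (∫ z, (c z.1 * L z.2 ^ k) * g z), ← hpoly P,
      ← integral_sub (hcyl c hc) (hcyl _ hPc), ← Real.norm_eq_abs, ← integral_const_mul]
    refine norm_integral_le_of_norm_le (hI.norm.const_mul ε)
      (Filter.Eventually.of_forall fun z => ?_)
    by_cases h : z ∈ Set.Icc α β ×ˢ Metric.closedBall (0 : E) R
    · have h0 : 0 < z.1 := hα.trans_le h.1.1
      have h1 := hP z.1 h.1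
      have h2 : (c z.1 * L z.2 ^ k) * g z - (z.1 ^ p * P.eval (z.1 ^ δ) * L z.2 ^ k) * g z =
          -(P.eval (z.1 ^ δ) - c z.1 * z.1 ^ (-p)) * ((z.1 ^ p * L z.2 ^ k) • g z) := by
        have : z.1 ^ (-p) * z.1 ^ p = 1 := by rw [← Real.rpow_add h0]; simp
        rw [smul_eq_mul]
        linear_combination (-(c z.1) * L z.2 ^ k * g z) * this
      rw [h2, norm_mul, norm_neg, Real.norm_eq_abs (_ - _)]
      gcongr
    · simp [hg z h]
  rw [← abs_nonpos_iff]
  refine le_of_forall_pos_le_add fun η hη => ?_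
  set M := ∫ z : ℝ × E, ‖(z.1 ^ p * L z.2 ^ k) • g z‖
  have hM : 0 ≤ M := integral_nonneg fun z => norm_nonneg _
  -- The shift to `M + 1` covers the case `M = 0`.
  refine (hbound (η / (M + 1)) (by positivity)).trans ?_
  rw [zero_add, div_mul_eq_mul_div, div_le_iff₀ (by positivity)]
  nlinarith

omit [(volume : Measure E).IsAddHaarMeasure] in
lemma ae_eq_zero_of_forall_integral_mul_eq_zero [SFinite (volume : Measure E)]
    {α β R : ℝ} {g : ℝ × E → ℝ}
    (hg : SupportedInCylinder α β R g) (hi : Integrable g)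
    (h : ∀ (L : StrongDual ℝ E) (k : ℕ) (c : ℝ → ℝ), Continuous c →
      ∫ z, (c z.1 * L z.2 ^ k) * g z = 0) : g =ᵐ[volume] 0 := by
  refine ae_eq_zero_of_forall_integral_cexp_eq_zero hi fun Λ => ?_
  set a : ℝ := Λ (1, 0)
  set L : StrongDual ℝ E := Λ.comp (ContinuousLinearMap.inr ℝ ℝ E)
  have hΛ : ∀ z : ℝ × E, Λ z = a * z.1 + L z.2 := fun z => by
    have : z = z.1 • ((1 : ℝ), (0 : E)) + (0, z.2) := by ext <;> simp
    conv_lhs => rw [this]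
    rw [map_add, map_smul, smul_eq_mul, mul_comm]
    rfl
  -- Only the exponential in `x` is expanded; the factor in `τ` is handled by taking `c` to be a
  -- cosine or a sine.
  let G : ℕ → ℝ × E → ℂ := fun k z =>
    g z • (Complex.exp ((a * z.1 : ℝ) * Complex.I) * ((L z.2 : ℂ) * Complex.I) ^ k / k.factorial)
  have hreal : ∀ (k : ℕ) (c : ℝ → ℝ), Continuous c →
      Integrable fun z : ℝ × E => (c z.1 * L z.2 ^ k) * g z := fun k c hc =>
    hg.integrable_smul hi (by fun_prop)
  have hG : ∀ k, G k = fun z => (Complex.I ^ k / k.factorial) *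
      ((((Real.cos (a * z.1) * L z.2 ^ k) * g z : ℝ) : ℂ) +
        (((Real.sin (a * z.1) * L z.2 ^ k) * g z : ℝ) : ℂ) * Complex.I) := by
    intro k
    funext z
    simp only [G]
    rw [Complex.exp_mul_I, Complex.real_smul, ← Complex.ofReal_cos, ← Complex.ofReal_sin]
    push_cast
    ring
  have hc1 : ∀ k, Integrable fun z : ℝ × E =>
      (((Real.cos (a * z.1) * L z.2 ^ k) * g z : ℝ) : ℂ) := fun k =>
    (hreal k (fun τ => Real.cos (a * τ)) (by fun_prop)).ofReal
  have hc2 : ∀ k, Integrable fun z : ℝ × E =>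
      (((Real.sin (a * z.1) * L z.2 ^ k) * g z : ℝ) : ℂ) * Complex.I := fun k =>
    (hreal k (fun τ => Real.sin (a * τ)) (by fun_prop)).ofReal.mul_const _
  have hGi : ∀ k, Integrable (G k) := fun k => by
    rw [hG]
    exact ((hc1 k).add (hc2 k)).const_mul _
  have hG0 : ∀ k, ∫ z, G k z = 0 := fun k => by
    rw [hG, integral_const_mul, integral_add (hc1 k) (hc2 k), integral_mul_const,
      integral_complex_ofReal, integral_complex_ofReal, h L k (fun τ => Real.cos (a * τ)) (by fun_prop),
      h L k (fun τ => Real.sin (a * τ)) (by fun_prop)]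
    simp
  -- On the support `|L x| ≤ ‖L‖ R`, so the exponential series dominates and sum and integral may be
  -- exchanged.
  have hsum : Summable fun k => ∫ z, ‖G k z‖ := by
    refine Summable.of_nonneg_of_le (fun k => integral_nonneg fun z => norm_nonneg _)
      (fun k => ?_) ((Real.summable_pow_div_factorial (‖L‖ * R)).mul_right (∫ z, ‖g z‖))
    rw [← integral_const_mul]
    refine integral_mono (hGi k).norm (hi.norm.const_mul _) fun z => ?_
    by_cases hz : z ∈ Set.Icc α β ×ˢ Metric.closedBall (0 : E) R
    · have h1 : ‖L z.2‖ ≤ ‖L‖ * R := (L.le_opNorm _).trans (by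
        gcongr; simpa using hz.2)
      simp only [G, norm_smul, norm_div, norm_mul, norm_pow, Complex.norm_exp_ofReal_mul_I,
        Complex.norm_real, Complex.norm_I, Complex.norm_natCast, one_mul, mul_one]
      rw [mul_comm]
      gcongr
    · simp [G, hg z hz]
  have hs := hasSum_integral_of_summable_integral_norm hGi hsum
  simp only [hG0] at hs
  rw [← hs.unique hasSum_zero]
  refine integral_congr_ae (Filter.Eventually.of_forall fun z => ?_)
  simp only [G]
  have hexp := NormedSpace.expSeries_div_hasSum_exp ((L z.2 : ℂ) * Complex.I)
  have := ((hexp.mul_left (Complex.exp ((a * z.1 : ℝ) * Complex.I))).const_smul (g z)).tsum_eq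
  simp only [← mul_div_assoc] at this
  rw [this, ← Complex.exp_eq_exp_ℂ, ← Complex.exp_add, hΛ]
  congr 2
  push_cast
  ring

variable {𝕜 : Type*} [RCLike 𝕜]

omit [(volume : Measure E).IsAddHaarMeasure] in
lemma ae_eq_zero_of_moment_eq_zero_real [SFinite (volume : Measure E)] {α β R : ℝ}
    {g : ℝ × E → ℝ} (hα : 0 < α)
    (hg : SupportedInCylinder α β R g) (hi : Integrable g) {e : ℝ} (he : e = -1 ∨ e = 1)
    (h : ∀ (L : StrongDual ℝ E) (k : ℕ) (κ : ℝ), Admissible e κ (Module.finrank ℝ E) k →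
      moment g L k (κ + Module.finrank ℝ E / 2) = 0) : g =ᵐ[volume] 0 := by
  refine ae_eq_zero_of_forall_integral_mul_eq_zero hg hi fun L k c hc => ?_
  set d := Module.finrank ℝ E
  rcases he with he | he
  -- Admissible exponents are bounded above here, so the progression starts below the bound and
  -- descends. In the other case it ascends from `κ = 0`.
  · refine integral_continuousOn_mul_eq_zero (p := -((k : ℝ) + d + 2) / 2 + d / 2) (δ := -1)
      hα hg hi (by norm_num) (fun i => ?_) hc.continuousOn
    rw [show -((k : ℝ) + d + 2) / 2 + d / 2 + -1 * i = (-((k : ℝ) + d + 2) / 2 - i) + d / 2 by ring]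
    refine h L k _ (Or.inl ⟨he, ?_⟩)
    have : (0 : ℝ) ≤ i := by positivity
    linarith
  · refine integral_continuousOn_mul_eq_zero (p := d / 2) (δ := 1)
      hα hg hi (by norm_num) (fun i => ?_) hc.continuousOn
    rw [show (d : ℝ) / 2 + 1 * i = i + d / 2 by ring]
    exact h L k _ (Or.inr ⟨he, by positivity⟩)

omit [(volume : Measure E).IsAddHaarMeasure] in
lemma ae_eq_zero_of_moment_eq_zero [SFinite (volume : Measure E)] {α β R : ℝ}
    {g : ℝ × E → 𝕜} (hα : 0 < α)
    (hg : SupportedInCylinder α β R g) (hi : Integrable g) {e : ℝ} (he : e = -1 ∨ e = 1)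
    (h : ∀ (L : StrongDual ℝ E) (k : ℕ) (κ : ℝ), Admissible e κ (Module.finrank ℝ E) k →
      moment g L k (κ + Module.finrank ℝ E / 2) = 0) : g =ᵐ[volume] 0 := by
  have key : ∀ T : 𝕜 →L[ℝ] ℝ, (fun z => T (g z)) =ᵐ[volume] 0 := fun T => by
    refine ae_eq_zero_of_moment_eq_zero_real (α := α) (β := β) (R := R) hα
      (fun z hz => by simp [hg z hz])
      (T.integrable_comp hi) he fun L k κ hκ => ?_
    have h1 := T.integral_comp_comm (hg.integrable_moment hα hi L k
      (κ + Module.finrank ℝ E / 2))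
    have h2 := h L k κ hκ
    rw [moment] at h2 ⊢
    rw [h2, map_zero] at h1
    simpa only [map_smul] using h1
  filter_upwards [key RCLike.reCLM, key RCLike.imCLM] with z h1 h2
  exact RCLike.ext (by simpa using h1) (by simpa using h2)

/-- The transform in the lifted coordinates is injective. -/
lemma ae_eq_zero_of_integral_liftedIntegrand_eq_zero {α β R : ℝ} {g : ℝ × E → 𝕜} (hα : 0 < α)
    (hg : SupportedInCylinder α β R g) (hi : Integrable g) {s e : ℝ} (hs : 0 < s)
    (he : e = -1 ∨ e = 1)
    (h0 : ∀ᵐ q : ℝ × E, 0 < q.1 → ∫ w, liftedIntegrand s e g q w = 0) :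
    g =ᵐ[volume] 0 :=
  ae_eq_zero_of_moment_eq_zero hα hg hi he (moment_eq_zero hα hg hi hs h0)

end Uniqueness

/-! ### Polar coordinates on the hyperplane -/

section Polar

variable {E : Type*} [NormedAddCommGroup E] [NormedSpace ℝ E] [FiniteDimensional ℝ E]
  [MeasurableSpace E] [BorelSpace E] (μ : Measure E) [μ.IsAddHaarMeasure]
  {F : Type*} [NormedAddCommGroup F] [NormedSpace ℝ F]

lemma measurableEmbedding_polar :
    MeasurableEmbedding
      (fun q : Metric.sphere (0 : E) 1 × Set.Ioi (0 : ℝ) => (q.2 : ℝ) • (q.1 : E)) :=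
  (MeasurableEmbedding.subtype_coe (measurableSet_singleton (0 : E)).compl).comp
    (homeomorphUnitSphereProd E).symm.measurableEmbedding

variable [Nontrivial E]

lemma measurePreserving_polar :
    MeasurePreserving (fun q : Metric.sphere (0 : E) 1 × Set.Ioi (0 : ℝ) => (q.2 : ℝ) • (q.1 : E))
      (μ.toSphere.prod (.volumeIoiPow (Module.finrank ℝ E - 1))) μ := by
  have h1 := (μ.measurePreserving_homeomorphUnitSphereProd).symm
    (homeomorphUnitSphereProd E).toMeasurableEquiv
  have h2 : MeasurePreserving (Subtype.val : ({0}ᶜ : Set E) → E) (μ.comap (↑)) μ := by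
    refine ⟨measurable_subtype_coe, ?_⟩
    rw [map_comap_subtype_coe (measurableSet_singleton _).compl, restrict_compl_singleton]
  exact h2.comp h1

lemma integrable_polar {G : E → F} (hG : Integrable G μ) :
    Integrable (fun z : ℝ × Metric.sphere (0 : E) 1 =>
      z.1 ^ (Module.finrank ℝ E - 1) • G (z.1 • (z.2 : E)))
      ((volume.restrict (Set.Ioi 0)).prod μ.toSphere) := by
  have h1 := ((measurePreserving_polar μ).integrable_comp_emb measurableEmbedding_polar).2 hG
  -- This measure is `volumeIoiPow 0`, whose density is `r ^ 0 = 1`.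
  have : SigmaFinite (Measure.comap (Subtype.val : Set.Ioi (0 : ℝ) → ℝ) volume) := by
    simpa [Measure.volumeIoiPow] using
      (inferInstance : SigmaFinite (Measure.volumeIoiPow 0))
  have h2 := h1.swap
  rw [Measure.volumeIoiPow, prod_withDensity_left (by fun_prop),
    integrable_withDensity_iff_integrable_smul' (by fun_prop) (by simp)] at h2
  have hmap : MeasurePreserving
      (Prod.map Subtype.val id : Set.Ioi (0 : ℝ) × Metric.sphere (0 : E) 1 → _)
      ((Measure.comap Subtype.val volume).prod μ.toSphere)
      ((volume.restrict (Set.Ioi 0)).prod μ.toSphere) :=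
    MeasurePreserving.prod
      ⟨measurable_subtype_coe, map_comap_subtype_coe measurableSet_Ioi _⟩ (MeasurePreserving.id _)
  refine (hmap.integrable_comp_emb
    ((MeasurableEmbedding.subtype_coe measurableSet_Ioi).prodMap MeasurableEmbedding.id)).1
    (h2.congr (Filter.Eventually.of_forall fun z => ?_))
  have hz : (0 : ℝ) < z.1 := z.1.2
  simp [ENNReal.toReal_ofReal (pow_nonneg hz.le _)]

lemma integral_polar {G : E → F} (hG : Integrable G μ) :
    ∫ r in Set.Ioi (0 : ℝ), r ^ (Module.finrank ℝ E - 1) •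
      ∫ Θ : Metric.sphere (0 : E) 1, G (r • (Θ : E)) ∂μ.toSphere = ∫ w, G w ∂μ := by
  have h1 := ((measurePreserving_polar μ).integrable_comp_emb measurableEmbedding_polar).2 hG
  rw [← (measurePreserving_polar μ).integral_comp measurableEmbedding_polar G,
    integral_prod_symm _ (by exact h1), Measure.volumeIoiPow,
    integral_withDensity_eq_integral_toReal_smul (by fun_prop) (by simp),
    ← integral_subtype_comap measurableSet_Ioi]
  refine integral_congr_ae (Filter.Eventually.of_forall fun r => ?_)
  have hz : (0 : ℝ) < r := r.2
  simp [ENNReal.toReal_ofReal (pow_nonneg hz.le _)]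

end Polar

/-! ### The substitution `τ = s x_n²` -/

section Height

/-- The map `τ ↦ √(τ / s)` turns Lebesgue measure on `(0, ∞)` into `2 s z dz`. -/
lemma measurePreserving_sqrt_div {s : ℝ} (hs : 0 < s) :
    MeasurePreserving (fun τ : ℝ => Real.sqrt (τ / s)) (volume.restrict (Set.Ioi 0))
      ((volume.restrict (Set.Ioi 0)).withDensity fun z => ENNReal.ofReal (2 * s * z)) := by
  refine ⟨by fun_prop, Measure.ext fun A hA => ?_⟩
  rw [Measure.map_apply (by fun_prop) hA, withDensity_apply _ hA,
    Measure.restrict_apply (hA.preimage (by fun_prop)), Measure.restrict_restrict hA]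
  have himage : (fun τ : ℝ => Real.sqrt (τ / s)) ⁻¹' A ∩ Set.Ioi 0 =
      (fun z : ℝ => s * z ^ 2) '' (A ∩ Set.Ioi 0) := by
    ext τ
    constructor
    · rintro ⟨h1, h2 : 0 < τ⟩
      refine ⟨Real.sqrt (τ / s), ⟨h1, Real.sqrt_pos.2 (by positivity)⟩, ?_⟩
      simp only
      rw [Real.sq_sqrt (by positivity)]
      field_simp
    · rintro ⟨z, ⟨h1, h2 : 0 < z⟩, rfl⟩
      refine ⟨?_, ?_⟩
      · rw [Set.mem_preimage, mul_div_cancel_left₀ _ hs.ne', Real.sqrt_sq h2.le]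
        exact h1
      · exact mul_pos hs (by positivity)
  have hinj : Set.InjOn (fun z : ℝ => s * z ^ 2) (A ∩ Set.Ioi 0) := by
    rintro z ⟨-, hz : 0 < z⟩ w ⟨-, hw : 0 < w⟩ h
    exact (pow_left_inj₀ hz.le hw.le two_ne_zero).1 (mul_left_cancel₀ hs.ne' h)
  have := lintegral_image_eq_lintegral_abs_deriv_mul (hA.inter measurableSet_Ioi)
    (f := fun z : ℝ => s * z ^ 2) (f' := fun z => 2 * s * z)
    (fun z _ => (((hasDerivAt_pow 2 z).const_mul s).congr_deriv (by
      push_cast; ring)).hasDerivWithinAt) hinj (fun _ => 1)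
  rw [himage, ← setLIntegral_one, this]
  refine setLIntegral_congr_fun (hA.inter measurableSet_Ioi) fun z hz => ?_
  have hz' : 0 < z := hz.2
  rw [mul_one, abs_of_pos (by positivity)]

lemma measurePreserving_height {E : Type*} [MeasureSpace E] [SFinite (volume : Measure E)] {s : ℝ} (hs : 0 < s) :
    MeasurePreserving (fun z : ℝ × E => (z.2, Real.sqrt (z.1 / s)))
      (volume.restrict (Set.Ioi 0 ×ˢ Set.univ))
      ((volume.restrict (Set.univ ×ˢ Set.Ioi 0)).withDensity
        fun x : E × ℝ => ENNReal.ofReal (2 * s * x.2)) := by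
  have h := Measure.measurePreserving_swap.comp
    ((measurePreserving_sqrt_div hs).prod (MeasurePreserving.id (volume : Measure E)))
  rw [prod_withDensity_right (by fun_prop)] at h
  rw [Measure.volume_eq_prod, Measure.volume_eq_prod, ← Measure.prod_restrict,
    ← Measure.prod_restrict, Measure.restrict_univ]
  exact h

variable {E : Type*} [NormedAddCommGroup E] [NormedSpace ℝ E] [FiniteDimensional ℝ E]
  [MeasureSpace E] [BorelSpace E] [(volume : Measure E).IsAddHaarMeasure]
  {F : Type*} [NormedAddCommGroup F] [NormedSpace ℝ F]

/-- `f` in the coordinates `(τ, x')`, where `τ = s x_n²`, extended by zero. -/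
noncomputable def liftHeight (s : ℝ) (f : E × ℝ → F) (z : ℝ × E) : F :=
  if 0 < z.1 then f (z.2, Real.sqrt (z.1 / s)) else 0

omit [NormedAddCommGroup E] [NormedSpace ℝ E] [FiniteDimensional ℝ E]
  [BorelSpace E] [(volume : Measure E).IsAddHaarMeasure] [NormedSpace ℝ F] [MeasureSpace E] in
lemma liftHeight_eq_indicator (s : ℝ) (f : E × ℝ → F) :
    liftHeight s f = (Set.Ioi 0 ×ˢ Set.univ).indicator (fun z => f (z.2, Real.sqrt (z.1 / s))) := by
  funext z
  simp [liftHeight, Set.indicator_apply]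

omit [NormedAddCommGroup E] [NormedSpace ℝ E] [FiniteDimensional ℝ E]
  [BorelSpace E] [(volume : Measure E).IsAddHaarMeasure] [NormedSpace ℝ F] in
lemma liftHeight_ae_eq [SFinite (volume : Measure E)] {s : ℝ} (hs : 0 < s) {f g : E × ℝ → F}
    (h : f =ᵐ[volume] g) : liftHeight s f =ᵐ[volume] liftHeight s g := by
  have h1 : f =ᵐ[(volume.restrict (Set.univ ×ˢ Set.Ioi 0)).withDensity
      fun x : E × ℝ => ENNReal.ofReal (2 * s * x.2)] g :=
    (withDensity_absolutelyContinuous _ _).ae_eq (ae_restrict_of_ae h)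
  have h2 := (measurePreserving_height (E := E) hs).quasiMeasurePreserving.ae_eq_comp h1
  rw [Filter.EventuallyEq, ae_restrict_iff' (measurableSet_Ioi.prod MeasurableSet.univ)] at h2
  filter_upwards [h2] with z hz
  unfold liftHeight
  split_ifs with h0
  · exact hz ⟨h0, trivial⟩
  · rfl

omit [NormedSpace ℝ E] [FiniteDimensional ℝ E] [(volume : Measure E).IsAddHaarMeasure] in
lemma integrable_liftHeight [SFinite (volume : Measure E)] {s : ℝ} (hs : 0 < s) {f : E × ℝ → F}
    {K : Set (E × ℝ)} (hK : IsCompact K) (hf : Integrable f) (h0 : ∀ x, x ∉ K → f x = 0) :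
    Integrable (liftHeight s f) := by
  have h1 : Integrable fun x : E × ℝ => (2 * s * x.2) • f x := by
    have := hf.integrableOn.continuousOn_smul (f := fun x : E × ℝ => 2 * s * x.2)
      (by fun_prop) hK
    rwa [integrableOn_iff_integrable_of_support_subset] at this
    intro x hx
    by_contra h'
    exact hx (by simp [h0 x h'])
  have h2 : Integrable f ((volume.restrict (Set.univ ×ˢ Set.Ioi 0)).withDensity
      fun x : E × ℝ => ENNReal.ofReal (2 * s * x.2)) := by
    rw [integrable_withDensity_iff_integrable_smul' (by fun_prop) (by simp)]
    refine h1.integrableOn.congr ?_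
    filter_upwards [ae_restrict_mem (MeasurableSet.univ.prod measurableSet_Ioi)] with x hx
    have : 0 < x.2 := hx.2
    rw [ENNReal.toReal_ofReal (by positivity)]
  rw [liftHeight_eq_indicator, integrable_indicator_iff (measurableSet_Ioi.prod MeasurableSet.univ)]
  exact (measurePreserving_height hs).integrable_comp_of_integrable h2

omit [NormedAddCommGroup E] [NormedSpace ℝ E] [FiniteDimensional ℝ E]
  [BorelSpace E] [(volume : Measure E).IsAddHaarMeasure] [NormedSpace ℝ F] in
-- The density `2 s x_n` is positive on the upper half space, so null sets there can be pulled back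
-- to Lebesgue measure.
lemma ae_eq_zero_of_liftHeight_ae_eq_zero [SFinite (volume : Measure E)] {s : ℝ} (hs : 0 < s)
    {f : E × ℝ → F} (hf : StronglyMeasurable f) (hpos : ∀ x, x.2 ≤ 0 → f x = 0)
    (h : liftHeight s f =ᵐ[volume] 0) : f =ᵐ[volume] 0 := by
  have hσ := measurePreserving_height (E := E) hs
  have h1 : ∀ᵐ z ∂(volume.restrict (Set.Ioi 0 ×ˢ Set.univ) : Measure (ℝ × E)),
      f (z.2, Real.sqrt (z.1 / s)) = 0 := by
    rw [ae_restrict_iff' (measurableSet_Ioi.prod MeasurableSet.univ)]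
    filter_upwards [h] with z hz hz0
    rwa [liftHeight, if_pos (show 0 < z.1 from hz0.1)] at hz
  have h2 : ∀ᵐ x ∂((volume.restrict (Set.univ ×ˢ Set.Ioi 0)).withDensity
      fun x : E × ℝ => ENNReal.ofReal (2 * s * x.2)), f x = 0 := by
    rw [← hσ.map_eq, ae_map_iff hσ.measurable.aemeasurable
      (hf.measurableSet_eq_fun stronglyMeasurable_const)]
    exact h1
  have h3 := (withDensity_absolutelyContinuous' (μ := volume.restrict (Set.univ ×ˢ Set.Ioi 0))
    (f := fun x : E × ℝ => ENNReal.ofReal (2 * s * x.2)) (by fun_prop) (by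
      filter_upwards [ae_restrict_mem (MeasurableSet.univ.prod measurableSet_Ioi)] with x hx
      have : 0 < x.2 := hx.2
      simp only [ne_eq, ENNReal.ofReal_eq_zero, not_le]
      positivity)).ae_le h2
  have h4 := (ae_restrict_iff' (MeasurableSet.univ.prod measurableSet_Ioi)).1 h3
  filter_upwards [h4] with x hx
  rcases le_or_gt x.2 0 with h | h
  · exact hpos x h
  · exact hx ⟨trivial, h⟩

omit [NormedSpace ℝ E] [FiniteDimensional ℝ E] [BorelSpace E]
  [(volume : Measure E).IsAddHaarMeasure] [NormedSpace ℝ F] [MeasureSpace E] in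
lemma supportedInCylinder_liftHeight {s a b R : ℝ} (hs : 0 < s) (ha : 0 < a) {f : E × ℝ → F}
    {K : Set (E × ℝ)} (hK : K ⊆ {x | a ≤ x.2 ∧ x.2 ≤ b}) (hR : K ⊆ Metric.closedBall 0 R)
    (h0 : ∀ x, x ∉ K → f x = 0) :
    SupportedInCylinder (s * a ^ 2) (s * b ^ 2) R (liftHeight s f) := by
  intro z hz
  unfold liftHeight
  split_ifs with hz0
  · refine h0 _ fun hmem => hz ⟨?_, ?_⟩
    · obtain ⟨h1, h2⟩ := hK hmem
      simp only at h1 h2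
      have h3 := Real.sq_sqrt (show 0 ≤ z.1 / s by positivity)
      have h4 : s * (z.1 / s) = z.1 := by field_simp
      constructor
      · rw [← h4, ← h3]; gcongr
      · rw [← h4, ← h3]; gcongr
    · have := hR hmem
      rw [mem_closedBall_zero_iff] at this ⊢
      exact (le_max_left _ _).trans this
  · rfl

/-- The shear pulls null sets back to null sets, and almost every slice of a null set is null. -/
lemma liftedIntegrand_ae_eq (s e : ℝ) {g g' : ℝ × E → F} (h : g =ᵐ[volume] g') :
    ∀ᵐ q : ℝ × E, liftedIntegrand s e g q =ᵐ[volume] liftedIntegrand s e g' q := by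
  have h1 : ∀ᵐ p : (ℝ × E) × E, g p.1 = g' p.1 := by
    rw [Measure.volume_eq_prod]
    exact Measure.quasiMeasurePreserving_fst.ae h
  have h2 := (measurePreserving_shear (E := E) e).quasiMeasurePreserving.ae h1
  rw [Measure.volume_eq_prod] at h2
  filter_upwards [Measure.ae_ae_of_ae_prod h2] with q hq
  filter_upwards [hq] with w hw
  simp only [liftedIntegrand]
  rw [hw]

end Height

/-! ### Identification with the original transform -/

section Transform

variable {𝕜 : Type*} [RCLike 𝕜] {n : ℕ}

/-- The sign `-(-1) ^ j` with which `|x' - y|²` enters `τ = t - (-1) ^ j |x' - y|²`. -/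
noncomputable def surfaceSign (j : Fin 2) : ℝ := (-1) ^ ((j : ℕ) + 1)

lemma surfaceSign_zero : surfaceSign 0 = -1 := by simp [surfaceSign]

lemma surfaceSign_one : surfaceSign 1 = 1 := by simp [surfaceSign]

lemma surfaceSign_eq (j : Fin 2) : surfaceSign j = -1 ∨ surfaceSign j = 1 := by
  fin_cases j
  · exact Or.inl surfaceSign_zero
  · exact Or.inr surfaceSign_one

lemma radiusRange_ae_eq (j : Fin 2) {t : ℝ} (ht : 0 < t) :
    radiusRange j t =ᵐ[volume] {r : ℝ | 0 < r ∧ 0 < t + surfaceSign j * r ^ 2} := by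
  fin_cases j
  · have : {r : ℝ | 0 < r ∧ 0 < t + surfaceSign 0 * r ^ 2} = Set.Ioo 0 (Real.sqrt t) := by
      ext r
      simp only [surfaceSign_zero, Set.mem_ofPred_eq, Set.mem_Ioo]
      refine and_congr_right fun hr => ?_
      rw [Real.lt_sqrt hr.le]
      constructor <;> intro h <;> linarith
    simp only [Fin.zero_eta, radiusRange, if_true, this]
    exact Ioo_ae_eq_Icc.symm
  · have : {r : ℝ | 0 < r ∧ 0 < t + surfaceSign 1 * r ^ 2} = Set.Ioi 0 := by
      ext r
      simp only [surfaceSign_one, Set.mem_ofPred_eq, Set.mem_Ioi, and_iff_left_iff_imp]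
      intro hr
      positivity
    simp only [Fin.mk_one, radiusRange, this, one_ne_zero, if_false]
    exact Ioi_ae_eq_Ici.symm

/-- With `τ = t + e r²`, the squared arc density is `(τ + r²/s)/τ = 1 + r²/(sτ)`. -/
lemma surfaceIntegrand_eq_liftedIntegrand (j : Fin 2) {s : ℝ} (hs : 0 < s)
    (f : Hyper n × ℝ → 𝕜) (t : ℝ) (y : Hyper n) {r : ℝ} (hr : 0 < r)
    (ht : 0 < t + surfaceSign j * r ^ 2) (Θ : Metric.sphere (0 : Hyper n) 1) :
    surfaceIntegrand j s f t y r Θ =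
      liftedIntegrand s (surfaceSign j) (liftHeight s f) (t, y) (r • (Θ : Hyper n)) := by
  have hnorm : ‖r • (Θ : Hyper n)‖ = r := by
    rw [norm_smul, Real.norm_of_nonneg hr.le, norm_eq_of_mem_sphere, mul_one]
  rw [liftedIntegrand, hnorm, liftHeight, if_pos ht, surfaceIntegrand, surfaceHeight, arcDensity,
    areaFactor, hnorm, ← surfaceSign, add_comm y]
  congr 1
  rw [← Real.sqrt_div' _ ht.le]
  congr 1
  field_simp
  ring

lemma liftedIntegrand_liftHeight_of_nonpos {s e : ℝ} (f : Hyper n × ℝ → 𝕜) {t : ℝ} (y : Hyper n)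
    {w : Hyper n} (h : t + e * ‖w‖ ^ 2 ≤ 0) : liftedIntegrand s e (liftHeight s f) (t, y) w = 0 := by
  rw [liftedIntegrand, liftHeight, if_neg (not_lt.2 h), smul_zero]

/-- The transform in Cartesian instead of polar coordinates on the hyperplane. -/
lemma radonTransform_eq_integral_liftedIntegrand (hn : 2 ≤ n) (j : Fin 2) {s : ℝ} (hs : 0 < s)
    (f : Hyper n × ℝ → 𝕜) {t : ℝ} (ht : 0 < t) (y : Hyper n)
    (hi : Integrable (liftedIntegrand s (surfaceSign j) (liftHeight s f) (t, y))) :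
    RadonConverges j s f (t, y) ∧ radonTransform j s f (t, y) =
      ∫ w, liftedIntegrand s (surfaceSign j) (liftHeight s f) (t, y) w := by
  have hfin : Module.finrank ℝ (Hyper n) - 1 = n - 2 := by
    rw [finrank_euclideanSpace_fin]; omega
  have : Nontrivial (Hyper n) :=
    Module.nontrivial_of_finrank_pos (R := ℝ) (by rw [finrank_euclideanSpace_fin]; omega)
  have h1 := integrable_polar volume hi
  have h2 := integral_polar volume hi
  rw [hfin] at h1 h2
  set A : Set ℝ := {r : ℝ | 0 < r ∧ 0 < t + surfaceSign j * r ^ 2}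
  have hA : MeasurableSet A :=
    measurableSet_Ioi.inter (measurableSet_lt (f := fun _ : ℝ => (0 : ℝ))
      (g := fun r => t + surfaceSign j * r ^ 2) (by fun_prop) (by fun_prop))
  have hA0 : A ⊆ Set.Ioi 0 := fun r hr => hr.1
  have hres : volume.restrict (radiusRange j t) = volume.restrict A :=
    Measure.restrict_congr_set (radiusRange_ae_eq j ht)
  have : IsFiniteMeasure (sphereMeasure n) := by rw [sphereMeasure]; infer_instance
  constructor
  · rw [RadonConverges, hres]
    have hle : (volume.restrict A).prod (sphereMeasure n) ≤
        (volume.restrict (Set.Ioi 0)).prod (sphereMeasure n) :=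
      Measure.prod_mono (Measure.restrict_mono hA0 le_rfl) le_rfl
    refine (h1.mono_measure hle).congr ?_
    have hmem : ∀ᵐ z ∂((volume.restrict A).prod (sphereMeasure n)), z.1 ∈ A :=
      Measure.quasiMeasurePreserving_fst.ae (ae_restrict_mem hA)
    filter_upwards [hmem] with z hz
    rw [surfaceIntegrand_eq_liftedIntegrand j hs f t y hz.1 hz.2]
  · rw [radonTransform, hres, ← h2]
    have : ∀ r ∈ A, (r ^ (n - 2) • ∫ Θ, surfaceIntegrand j s f t y r Θ ∂sphereMeasure n) =
        r ^ (n - 2) • ∫ Θ : Metric.sphere (0 : Hyper n) 1, liftedIntegrand s (surfaceSign j)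
          (liftHeight s f) (t, y) (r • (Θ : Hyper n)) ∂(volume : Measure (Hyper n)).toSphere := by
      intro r hr
      simp_rw [surfaceIntegrand_eq_liftedIntegrand j hs f t y hr.1 hr.2]
      rfl
    rw [setIntegral_congr_fun hA this]
    -- Radii outside `A` have `τ ≤ 0`, where the lift was extended by zero.
    refine (setIntegral_eq_of_subset_of_forall_sdiff_eq_zero measurableSet_Ioi hA0
      fun r hr => ?_).symm
    have hr0 : 0 < r := hr.1
    have hr1 : t + surfaceSign j * r ^ 2 ≤ 0 := not_lt.1 fun h => hr.2 ⟨hr0, h⟩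
    rw [integral_eq_zero_of_ae, smul_zero]
    refine Filter.Eventually.of_forall fun Θ => liftedIntegrand_liftHeight_of_nonpos f y ?_
    rwa [norm_smul, Real.norm_of_nonneg hr0.le, norm_eq_of_mem_sphere, mul_one]

lemma MemL2c.sub {a b : ℝ} {f g : Hyper n × ℝ → 𝕜} (hf : MemL2c a b f) (hg : MemL2c a b g) :
    MemL2c a b (f - g) := by
  obtain ⟨hf, K, hK, hKs, hf0⟩ := hf
  obtain ⟨hg, K', hK', hKs', hg0⟩ := hg
  refine ⟨hf.sub hg, K ∪ K', hK.union hK', Set.union_subset hKs hKs', ?_⟩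
  filter_upwards [hf0, hg0] with x h1 h2 hx
  rw [Set.mem_union, not_or] at hx
  rw [Pi.sub_apply, h1 hx.1, h2 hx.2, sub_zero]

/-- A representative that is measurable and vanishes everywhere outside a compact set. -/
lemma MemL2c.exists_representative {a b : ℝ} {f : Hyper n × ℝ → 𝕜} (hf : MemL2c a b f) :
    ∃ (h : Hyper n × ℝ → 𝕜) (K : Set (Hyper n × ℝ)), IsCompact K ∧
      K ⊆ {x | a ≤ x.2 ∧ x.2 ≤ b} ∧ StronglyMeasurable h ∧ Integrable h ∧ (∀ x, x ∉ K → h x = 0) ∧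
      f =ᵐ[volume] h := by
  obtain ⟨hf, K, hK, hKs, hf0⟩ := hf
  have heq : f =ᵐ[volume] K.indicator (hf.1.mk f) := by
    filter_upwards [hf0, hf.1.ae_eq_mk] with x h1 h2
    by_cases hx : x ∈ K
    · rw [Set.indicator_of_mem hx, h2]
    · rw [Set.indicator_of_notMem hx, h1 hx]
  refine ⟨_, K, hK, hKs, hf.1.stronglyMeasurable_mk.indicator hK.measurableSet, ?_,
    fun x hx => Set.indicator_of_notMem hx _, heq⟩
  rw [integrable_indicator_iff hK.measurableSet]
  -- On a set of finite measure, square integrable functions are integrable.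
  have : IsFiniteMeasure ((volume : Measure (Hyper n × ℝ)).restrict K) :=
    ⟨by simpa using hK.measure_lt_top⟩
  exact (((memLp_congr_ae hf.1.ae_eq_mk).1 hf).restrict K).integrable (by norm_num)

lemma SupportedInCylinder.exists_liftHeight {s a b : ℝ} (hs : 0 < s) (ha : 0 < a)
    {f : Hyper n × ℝ → 𝕜} {K : Set (Hyper n × ℝ)} (hK : IsCompact K)
    (hKs : K ⊆ {x | a ≤ x.2 ∧ x.2 ≤ b}) (h0 : ∀ x, x ∉ K → f x = 0) :
    ∃ R, SupportedInCylinder (s * a ^ 2) (s * b ^ 2) R (liftHeight s f) := by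
  obtain ⟨R, hR⟩ := hK.isBounded.subset_closedBall 0
  exact ⟨R, supportedInCylinder_liftHeight hs ha hKs hR h0⟩

lemma MemL2c.ae_integrable_liftedIntegrand {s a b : ℝ} (hs : 0 < s) (ha : 0 < a)
    {f : Hyper n × ℝ → 𝕜} (hf : MemL2c a b f) (j : Fin 2) :
    ∀ᵐ q : ℝ × Hyper n, 0 < q.1 →
      Integrable (liftedIntegrand s (surfaceSign j) (liftHeight s f) q) := by
  obtain ⟨h, K, hK, hKs, -, hi, h0, heq⟩ := hf.exists_representative
  obtain ⟨R, hR⟩ := SupportedInCylinder.exists_liftHeight hs ha hK hKs h0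
  filter_upwards [_root_.ae_integrable_liftedIntegrand (by positivity) hR
    (integrable_liftHeight hs hK hi h0) hs (surfaceSign_eq j),
    liftedIntegrand_ae_eq s (surfaceSign j) (liftHeight_ae_eq hs heq)] with q h1 h2 hq
  exact (h1 hq).congr h2.symm

lemma ae_parameterMeasure_iff {p : ℝ × Hyper n → Prop} :
    (∀ᵐ q ∂(parameterMeasure n), p q) ↔ ∀ᵐ q : ℝ × Hyper n, 0 < q.1 → p q :=
  ae_restrict_iff' (measurableSet_lt measurable_const measurable_fst)

lemma MemL2c.ae_radonTransform_eq (hn : 2 ≤ n) {s a b : ℝ} (hs : 0 < s) (ha : 0 < a)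
    {f : Hyper n × ℝ → 𝕜} (hf : MemL2c a b f) (j : Fin 2) :
    ∀ᵐ q : ℝ × Hyper n, 0 < q.1 → RadonConverges j s f q ∧ radonTransform j s f q =
      ∫ w, liftedIntegrand s (surfaceSign j) (liftHeight s f) q w := by
  filter_upwards [hf.ae_integrable_liftedIntegrand hs ha j] with q hq hq0
  exact radonTransform_eq_integral_liftedIntegrand hn j hs f hq0 q.2 (hq hq0)

lemma liftedIntegrand_liftHeight_sub (s e : ℝ) (f g : Hyper n × ℝ → 𝕜) (q : ℝ × Hyper n) :
    liftedIntegrand s e (liftHeight s (f - g)) q =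
      liftedIntegrand s e (liftHeight s f) q - liftedIntegrand s e (liftHeight s g) q := by
  funext w
  simp only [liftedIntegrand, liftHeight, Pi.sub_apply]
  split_ifs
  · rw [smul_sub]
  · simp

end Transform

theorem theorem4p1 {𝕜 : Type*} [RCLike 𝕜] (n : ℕ) (hn : 2 ≤ n) (j : Fin 2)
    (s : ℝ) (hs : 0 < s) (a b : ℝ) (ha : 0 < a) (hab : a < b) :
    (∀ f : Hyper n × ℝ → 𝕜, MemL2c a b f →
      ∀ᵐ q ∂(parameterMeasure n), RadonConverges j s f q) ∧
    (∀ f g : Hyper n × ℝ → 𝕜, MemL2c a b f → MemL2c a b g → f =ᵐ[volume] g →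
      radonTransform j s f =ᵐ[parameterMeasure n] radonTransform j s g) ∧
    (∀ f g : Hyper n × ℝ → 𝕜, MemL2c a b f → MemL2c a b g →
      radonTransform j s f =ᵐ[parameterMeasure n] radonTransform j s g →
      f =ᵐ[volume] g) := by
  refine ⟨fun f hf => ?_, fun f g hf hg hfg => ?_, fun f g hf hg hR => ?_⟩
  · rw [ae_parameterMeasure_iff]
    filter_upwards [hf.ae_radonTransform_eq hn hs ha j] with q hq hq0
    exact (hq hq0).1
  · rw [Filter.EventuallyEq, ae_parameterMeasure_iff]
    filter_upwards [hf.ae_radonTransform_eq hn hs ha j, hg.ae_radonTransform_eq hn hs ha j,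
      liftedIntegrand_ae_eq s (surfaceSign j) (liftHeight_ae_eq hs hfg)] with q h1 h2 h3 hq0
    rw [(h1 hq0).2, (h2 hq0).2, integral_congr_ae h3]
  · rw [Filter.EventuallyEq, ae_parameterMeasure_iff] at hR
    -- By linearity it suffices to treat the difference, through a representative supported in a
    -- compact set.
    obtain ⟨h, K, hK, hKs, hm, hi, h0, heq⟩ := (hf.sub hg).exists_representative
    obtain ⟨R, hsupp⟩ := SupportedInCylinder.exists_liftHeight hs ha hK hKs h0
    have hzero : ∀ᵐ q : ℝ × Hyper n, 0 < q.1 →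
        ∫ w, liftedIntegrand s (surfaceSign j) (liftHeight s h) q w = 0 := by
      filter_upwards [hR, hf.ae_radonTransform_eq hn hs ha j, hg.ae_radonTransform_eq hn hs ha j,
        hf.ae_integrable_liftedIntegrand hs ha j, hg.ae_integrable_liftedIntegrand hs ha j,
        liftedIntegrand_ae_eq s (surfaceSign j) (liftHeight_ae_eq hs heq)]
        with q h1 h2 h3 h4 h5 h6 hq0
      rw [← integral_congr_ae h6, liftedIntegrand_liftHeight_sub, integral_sub' (h4 hq0) (h5 hq0),
        ← (h2 hq0).2, ← (h3 hq0).2, h1 hq0, sub_self]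
    have hlift := ae_eq_zero_of_integral_liftedIntegrand_eq_zero (by positivity) hsupp
      (integrable_liftHeight hs hK hi h0) hs (surfaceSign_eq j) hzero
    -- The lift sees only `x_n > 0`; since `a > 0`, nothing is lost.
    have hh := ae_eq_zero_of_liftHeight_ae_eq_zero hs hm
      (fun x hx => h0 x fun hxK => absurd (hKs hxK).1 (by linarith)) hlift
    filter_upwards [heq, hh] with x h1 h2
    rw [h2, Pi.sub_apply, Pi.zero_apply, sub_eq_zero] at h1
    exact h1
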